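/- Let $\Omega\subset\mathbb{R}^2$ be a convex polygon (the convex hull of finitely many points, with nonempty interior). For distinct $p,q\in\operatorname{int}(\Omega)$ let $p',q'$ be the endpoints of the chord of $\Omega$ through $p$ and $q$, in the order $p',p,q,q'$, and let $$d_\Omega(p,q)=\frac12\ln\left(\frac{\|q-p'\|}{\|p-p'\|}\cdot\frac{\|p-q'\|}{\|q-q'\|}\right),\qquad d_\Omega(p,p)=0,$$ be the Hilbert distance. For $c,p\in\operatorname{int}(\Omega)$ let $B(c,p)=\{q\in\operatorname{int}(\Omega): d_\Omega(c,q)\le d_\Omega(c,p)\}$ be the Hilbert ball centered at $c$ of radius $d_\Omega(c,p)$. Let $x\in\partial\Omega$, let $p\in\operatorname{int}(\Omega)$, let $u$ be a unit vector directed from $x$ into the interior of $\Omega$ (that is, $x+tu\in\operatorname{int}(\Omega)$ for some $t>0$), and put $x_\delta=x+\delta u$ for $\delta>0$. Then, as $\delta\to0^+$, the balls $B(x_\delta,p)$ converge in the Hausdorff distance to a nonempty compact set, necessarily unique, called the Hilbert ball at infinity $B_u(x,p)$. Moreover, $B_u(x,p)$ is a convex polygon (with nonempty interior), it is contained in $\Omega$,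 and both $x$ and $p$ lie on its boundary. -/

import Mathlib

/-- The Euclidean plane. -/
abbrev Plane : Type := EuclideanSpace ℝ (Fin 2)

/-- A convex polygon: the convex hull of finitely many points of the plane, with nonempty interior
(hence a closed, bounded, full-dimensional convex set). -/
def IsConvexPolygon (Ω : Set Plane) : Prop :=
  (∃ V : Finset Plane, Ω = convexHull ℝ (V : Set Plane)) ∧ (interior Ω).Nonempty

/-- For distinct `p`, `q` in `Ω`, the endpoint beyond `q` of the chord of `Ω` through `p` and `q`:
the last point of `Ω` on the ray from `p` through `q`. -/
noncomputable def chordEnd (Ω : Set Plane) (p q : Plane) : Plane :=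
  AffineMap.lineMap p q (sSup {t : ℝ | AffineMap.lineMap p q t ∈ Ω})

open Classical in
/-- The Hilbert distance: with `p' = chordEnd Ω q p` and `q' = chordEnd Ω p q` the endpoints of the
chord through `p ≠ q`, in the order `p', p, q, q'`, it is half the logarithm of the cross ratio
`(‖q - p'‖ / ‖p - p'‖) * (‖p - q'‖ / ‖q - q'‖)`; and it is `0` if `p = q`. -/
noncomputable def hilbertDist (Ω : Set Plane) (p q : Plane) : ℝ :=
  if p = q then 0
  else 1 / 2 * Real.log
    ((‖q - chordEnd Ω q p‖ / ‖p - chordEnd Ω q p‖) *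
      (‖p - chordEnd Ω p q‖ / ‖q - chordEnd Ω p q‖))

/-- The (closed) Hilbert ball of radius `ρ` centered at `c`. -/
def hilbertBall (Ω : Set Plane) (c : Plane) (ρ : ℝ) : Set Plane :=
  {q | q ∈ interior Ω ∧ hilbertDist Ω c q ≤ ρ}

/-- The Hilbert ball centered at `c` whose boundary passes through `p`. -/
def hilbertBallThrough (Ω : Set Plane) (c p : Plane) : Set Plane :=
  hilbertBall Ω c (hilbertDist Ω c p)

/-- `u` is a unit vector directed from `x` into the interior of `Ω`. -/
def IsInwardDirection (Ω : Set Plane) (x u : Plane) : Prop :=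
  ‖u‖ = 1 ∧ ∃ t : ℝ, 0 < t ∧ x + t • u ∈ interior Ω

open Filter Topology in
/-- `K` is the Hilbert ball at infinity determined by `x` and `u` and passing through `p`: the
nonempty compact set to which the balls centered at `x + δ • u` through `p` converge in the
Hausdorff distance as `δ` decreases to `0`. -/
def IsHilbertBallAtInfinity (Ω : Set Plane) (x u p : Plane) (K : Set Plane) : Prop :=
  K.Nonempty ∧ IsCompact K ∧
    Tendsto (fun δ : ℝ => Metric.hausdorffEDist (hilbertBallThrough Ω (x + δ • u) p) K)
      (𝓝[>] 0) (𝓝 0)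

/-!
Let `Ω` be cut out by affine inequalities `0 ≤ f i`, normalised so that `f i p = 1`; such
inequalities exist because the polar body of `Ω` at `p` is again the convex hull of finitely many
points. Comparing the chord endpoints with the walls gives
`exp (2 d(c, q)) = max_{i,j} (f i c / f i q) * (f j q / f j c)`.
Hence the ball centered at `c` through `p` is the part of `interior Ω` where finitely many affine
inequalities hold, with coefficients depending only on the values `f i c` and, up to a common
factor, on the `1 / f j c`. For `c = x + δ • u` and the factor `δ` these coefficients converge as
`δ → 0`. The limiting system is strictly feasible at points `x + t • u` with `t > 0` small, and near
a strictly feasible system a bounded solution set depends continuously on the coefficients for the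
Hausdorff distance.
-/

open Filter Topology

section Polyhedron

variable {E : Type*} [NormedAddCommGroup E] [NormedSpace ℝ E] {ι κ : Type*}
  {f : ι → E →ᴬ[ℝ] ℝ} {q r z : E}

theorem apply_lineMap_eq (g : E →ᴬ[ℝ] ℝ) (q r : E) (t : ℝ) :
    g (AffineMap.lineMap q r t) = (1 - t) * g q + t * g r := by
  rw [g.apply_lineMap, AffineMap.lineMap_apply_ring]

theorem apply_add_smul_eq (g : E →ᴬ[ℝ] ℝ) (x u : E) (t : ℝ) :
    g (x + t • u) = g x + t * g.contLinear u := by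
  simpa [add_comm] using g.map_vadd x (t • u)

theorem contLinear_pos_of_apply_add_smul_pos {g : E →ᴬ[ℝ] ℝ} {x u : E} {t : ℝ} (ht : 0 < t)
    (hx : g x = 0) (hxu : 0 < g (x + t • u)) : 0 < g.contLinear u := by
  rw [apply_add_smul_eq, hx, zero_add] at hxu
  exact pos_of_mul_pos_right hxu ht.le

/-- The closed polyhedron cut out by a family of affine inequalities `0 ≤ f i`. -/
def polyhedron (f : ι → E →ᴬ[ℝ] ℝ) : Set E :=
  {q | ∀ i, 0 ≤ f i q}

theorem polyhedron_eq_iInter (f : ι → E →ᴬ[ℝ] ℝ) :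
    polyhedron f = ⋂ i, f i ⁻¹' Set.Ici 0 := by
  ext
  simp [polyhedron]

theorem convex_polyhedron (f : ι → E →ᴬ[ℝ] ℝ) : Convex ℝ (polyhedron f) :=
  polyhedron_eq_iInter f ▸
    convex_iInter fun i => (convex_Ici 0).affine_preimage (f i : E →ᵃ[ℝ] ℝ)

theorem isClosed_polyhedron (f : ι → E →ᴬ[ℝ] ℝ) : IsClosed (polyhedron f) :=
  polyhedron_eq_iInter f ▸ isClosed_iInter fun i => isClosed_Ici.preimage (f i).continuous

theorem polyhedron_sumElim (f : ι → E →ᴬ[ℝ] ℝ) (g : κ → E →ᴬ[ℝ] ℝ) :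
    polyhedron (Sum.elim f g) = polyhedron f ∩ polyhedron g := by
  ext
  simp [polyhedron]

theorem pos_of_mem_interior {g : E →ᴬ[ℝ] ℝ} {s : Set E} (hs : ∀ y ∈ s, 0 ≤ g y)
    (hz : 0 < g z) (hq : q ∈ interior s) : 0 < g q := by
  have hnear : ∀ᶠ t in 𝓝[<] (0 : ℝ), AffineMap.lineMap q z t ∈ s :=
    nhdsWithin_le_nhds <| AffineMap.lineMap_continuous.continuousAt.eventually_mem <| by
      simpa using mem_interior_iff_mem_nhds.1 hq
  obtain ⟨t, hts, ht⟩ := (hnear.and self_mem_nhdsWithin).exists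
  have hbeyond := hs _ hts
  rw [apply_lineMap_eq] at hbeyond
  have ht0 : t < 0 := ht
  have hneg := mul_neg_of_neg_of_pos ht0 hz
  exact pos_of_mul_pos_right (by linarith) (by linarith : 0 ≤ 1 - t)

theorem isOpen_setOf_forall_pos [Finite ι] (f : ι → E →ᴬ[ℝ] ℝ) :
    IsOpen {q | ∀ i, 0 < f i q} := by
  simp only [Set.ofPred_forall]
  exact isOpen_iInter_of_finite fun i => isOpen_lt continuous_const (f i).continuous

theorem interior_polyhedron [Finite ι] (hz : ∀ i, 0 < f i z) :
    interior (polyhedron f) = {q | ∀ i, 0 < f i q} :=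
  Set.Subset.antisymm
    (fun _ hq i => pos_of_mem_interior (s := polyhedron f) (fun _ hy => hy i) (hz i) hq)
    (interior_maximal (fun _ hq i => (hq i).le) (isOpen_setOf_forall_pos f))

theorem mem_frontier_polyhedron_iff [Finite ι] (hz : ∀ i, 0 < f i z) :
    q ∈ frontier (polyhedron f) ↔ q ∈ polyhedron f ∧ ∃ i, f i q = 0 := by
  rw [(isClosed_polyhedron f).frontier_eq, interior_polyhedron hz, Set.mem_sdiff]
  refine and_congr_right fun hq => ?_
  simp only [Set.mem_ofPred_eq, not_forall, not_lt]
  exact exists_congr fun i => (hq i).ge_iff_eq'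

theorem exists_apply_ne_zero_of_isBounded (hb : Bornology.IsBounded (polyhedron f))
    (hq : q ∈ polyhedron f) (hqr : r ≠ q) : ∃ i, f i r ≠ 0 := by
  by_contra! hr
  have hray : ∀ t : ℝ, 0 ≤ t → AffineMap.lineMap r q t ∈ polyhedron f := fun t ht i => by
    rw [apply_lineMap_eq, hr i, mul_zero, zero_add]
    exact mul_nonneg ht (hq i)
  have hbdd := (antilipschitzWith_lineMap (𝕜 := ℝ) hqr).isBounded_preimage hb
  exact (not_bddAbove_Ici (0 : ℝ)) ((hbdd.subset hray).bddAbove)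

theorem eventually_lineMap_mem_polyhedron [Finite ι] (hq : q ∈ polyhedron f)
    (hqr : ∀ i, f i q = 0 → f i r = 0) :
    ∀ᶠ t in 𝓝 (0 : ℝ), AffineMap.lineMap q r t ∈ polyhedron f := by
  refine eventually_all.2 fun i => ?_
  rcases (hq i).eq_or_lt with htight | hloose
  · simp [htight.symm, hqr i htight.symm]
  · have hcont : Continuous fun t : ℝ => f i (AffineMap.lineMap q r t) :=
      (f i).continuous.comp AffineMap.lineMap_continuous
    exact ((hcont.tendsto' 0 _ (by simp)).eventually_const_lt hloose).mono fun _ => le_of_lt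

theorem eq_of_mem_extremePoints_polyhedron [Finite ι]
    (hq : q ∈ Set.extremePoints ℝ (polyhedron f)) (hqr : ∀ i, f i q = 0 → f i r = 0) :
    q = r := by
  have hnear := eventually_lineMap_mem_polyhedron hq.1 hqr
  have hnear_neg := (continuous_neg.tendsto' (0 : ℝ) 0 neg_zero).eventually hnear
  obtain ⟨t, ⟨ht, ht_neg⟩, ht0⟩ :=
    ((hnear.and hnear_neg).filter_mono nhdsWithin_le_nhds |>.and
      (self_mem_nhdsWithin (s := Set.Ioi (0 : ℝ)))).exists
  have hmid : q ∈ openSegment ℝ (AffineMap.lineMap q r t) (AffineMap.lineMap q r (-t)) := by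
    refine ⟨1 / 2, 1 / 2, by norm_num, by norm_num, by norm_num, ?_⟩
    simp only [AffineMap.lineMap_apply_module]
    module
  exact (AffineMap.lineMap_eq_left_iff.1 (hq.2 ht ht_neg hmid)).resolve_right ht0.ne'

theorem finite_extremePoints_polyhedron [Finite ι] (f : ι → E →ᴬ[ℝ] ℝ) :
    (Set.extremePoints ℝ (polyhedron f)).Finite :=
  Set.Finite.of_injOn (f := fun q => {i | f i q = 0}) (Set.mapsTo_univ _ _)
    (fun _ hq _ _ hqr => eq_of_mem_extremePoints_polyhedron hq fun _ hi => hqr.subset hi)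
    Set.finite_univ

theorem exists_finset_polyhedron_eq_convexHull [Finite ι] (hc : IsCompact (polyhedron f)) :
    ∃ V : Finset E, polyhedron f = convexHull ℝ (V : Set E) := by
  have hfin := finite_extremePoints_polyhedron f
  refine ⟨hfin.toFinset, ?_⟩
  rw [hfin.coe_toFinset, ← (hfin.isClosed_convexHull ℝ).closure_eq,
    closure_convexHull_extremePoints hc (convex_polyhedron f)]

end Polyhedron

section Polar

variable {E : Type*} [NormedAddCommGroup E] [NormedSpace ℝ E] {s : Set E} {z : E}

/-- The one-sided polar body of `s` with respect to the point `z`. -/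
def polarBody (s : Set E) (z : E) : Set (StrongDual ℝ E) :=
  {l | ∀ y ∈ s, l (y - z) ≤ 1}

theorem polarBody_convexHull (s : Set E) (z : E) :
    polarBody (convexHull ℝ s) z = polarBody s z := by
  refine Set.Subset.antisymm (fun l hl y hy => hl y (subset_convexHull ℝ s hy)) fun l hl => ?_
  have hhalf : Convex ℝ {y | l y ≤ 1 + l z} := convex_halfSpace_le l.isLinear _
  simpa [polarBody, sub_le_iff_le_add, Set.subset_def] using
    hhalf.convexHull_subset_iff.2 fun y hy => by
      simpa [sub_le_iff_le_add] using hl y hy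

theorem polarBody_eq_polyhedron (s : Set E) (z : E) :
    polarBody s z = polyhedron fun y : s => ContinuousAffineMap.const ℝ (StrongDual ℝ E) (1 : ℝ) -
      (ContinuousLinearMap.apply ℝ ℝ ((y : E) - z)).toContinuousAffineMap := by
  ext
  simp [polarBody, polyhedron]

theorem isBounded_polarBody (hz : z ∈ interior s) : Bornology.IsBounded (polarBody s z) := by
  have hs : s ∈ 𝓝 z := mem_interior_iff_mem_nhds.1 hz
  have hadd : ∀ᶠ y in 𝓝 (0 : E), z + y ∈ s :=
    (continuous_const_add z).tendsto' 0 z (add_zero z) hs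
  have hsub : ∀ᶠ y in 𝓝 (0 : E), z - y ∈ s :=
    (continuous_const.sub continuous_id).tendsto' 0 z (sub_zero z) hs
  refine (NormedSpace.isBounded_polar_of_mem_nhds_zero ℝ (hadd.and hsub)).subset
    fun l hl => (StrongDual.mem_polar_iff ℝ _).2 fun y hy => abs_le.2 ⟨?_, ?_⟩
  · have := hl _ hy.2
    rw [sub_sub_cancel_left, map_neg] at this
    linarith
  · simpa using hl _ hy.1

theorem exists_finset_polarBody_convexHull_eq [FiniteDimensional ℝ E] (V : Finset E)
    (hz : z ∈ interior (convexHull ℝ (V : Set E))) :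
    ∃ W : Finset (StrongDual ℝ E),
      polarBody (convexHull ℝ (V : Set E)) z = convexHull ℝ (W : Set (StrongDual ℝ E)) := by
  have hb := isBounded_polarBody hz
  rw [polarBody_convexHull, polarBody_eq_polyhedron] at hb ⊢
  exact exists_finset_polyhedron_eq_convexHull
    (Metric.isCompact_of_isClosed_isBounded (isClosed_polyhedron _) hb)

theorem mem_iff_forall_mem_polarBody_le_one (hs : Convex ℝ s) (hcl : IsClosed s) (hz : z ∈ s)
    {q : E} : q ∈ s ↔ ∀ l ∈ polarBody s z, l (q - z) ≤ 1 := by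
  refine ⟨fun hq l hl => hl q hq, fun hq => ?_⟩
  by_contra hqs
  obtain ⟨l, c, hl, hc⟩ := geometric_hahn_banach_closed_point hs hcl hqs
  have hzc : 0 < c - l z := sub_pos.2 (hl z hz)
  have hmem : (c - l z)⁻¹ • l ∈ polarBody s z := fun y hy => by
    rw [smul_apply, smul_eq_mul, map_sub, inv_mul_le_one₀ hzc]
    linarith [hl y hy]
  have hle := hq _ hmem
  rw [smul_apply, smul_eq_mul, map_sub, inv_mul_le_one₀ hzc] at hle
  linarith

theorem exists_convexHull_eq_polyhedron [FiniteDimensional ℝ E] (V : Finset E)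
    (hz : z ∈ interior (convexHull ℝ (V : Set E))) :
    ∃ (W : Finset (StrongDual ℝ E)) (f : W → E →ᴬ[ℝ] ℝ),
      (∀ i, f i z = 1) ∧ convexHull ℝ (V : Set E) = polyhedron f := by
  obtain ⟨W, hW⟩ := exists_finset_polarBody_convexHull_eq V hz
  refine ⟨W, fun w => ContinuousAffineMap.const ℝ E (1 + (w : StrongDual ℝ E) z) -
    (w : StrongDual ℝ E).toContinuousAffineMap, fun w => by simp, Set.ext fun q => ?_⟩
  have hhalf : Convex ℝ {l : StrongDual ℝ E | l (q - z) ≤ 1} :=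
    convex_halfSpace_le (ContinuousLinearMap.apply ℝ ℝ (q - z)).isLinear 1
  rw [mem_iff_forall_mem_polarBody_le_one (convex_convexHull ℝ _)
    (V.finite_toSet.isClosed_convexHull ℝ) (interior_subset hz), hW]
  refine (hhalf.convexHull_subset_iff (s := (W : Set (StrongDual ℝ E)))).trans ?_
  simp [polyhedron, Set.subset_def]

end Polar

section HausdorffContinuity

variable {E : Type*} [NormedAddCommGroup E] [NormedSpace ℝ E] {ι α : Type*}

theorem abs_apply_le_norm_mul (g : E →ᴬ[ℝ] ℝ) (q : E) : |g q| ≤ ‖g‖ * (1 + ‖q‖) :=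
  calc |g q| = |g 0 + ‖q‖ * 0 + g.contLinear q| := by
        simpa using congrArg abs (apply_add_smul_eq g 0 q 1)
    _ ≤ |g 0| + ‖g.contLinear q‖ := by simpa using abs_add_le (g 0) (g.contLinear q)
    _ ≤ ‖g‖ + ‖g‖ * ‖q‖ := add_le_add g.norm_image_zero_le
        (g.contLinear.le_of_opNorm_le g.norm_contLinear_le q)
    _ = ‖g‖ * (1 + ‖q‖) := by ring

/- Moving a point by a fraction `t` of the way toward a point `z` where all constraints are slack
absorbs perturbations of the constraints up to `t` times the slack at `z`. -/
theorem lineMap_mem_polyhedron_of_abs_sub_le {g h : ι → E →ᴬ[ℝ] ℝ} {q z : E} {t : ℝ}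
    (ht0 : 0 ≤ t) (ht1 : t ≤ 1) (hz : ∀ i, 0 ≤ h i z) (hq : q ∈ polyhedron g)
    (hgh : ∀ i, |g i q - h i q| ≤ t * h i z) :
    AffineMap.lineMap q z t ∈ polyhedron h := fun i => by
  have hclose := (abs_le.1 (hgh i)).2
  have hgq := hq i
  calc 0 ≤ (1 - t) * g i q + t * (t * h i z) := by
        have := sub_nonneg.2 ht1
        have := hz i
        positivity
    _ ≤ (1 - t) * h i q + t * h i z := by nlinarith
    _ = h i (AffineMap.lineMap q z t) := (apply_lineMap_eq _ _ _ _).symm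

theorem lineMap_mem_polyhedron_of_abs_apply_lineMap_sub_le {g h : ι → E →ᴬ[ℝ] ℝ} {q z : E}
    {t : ℝ} (ht1 : t ≤ 1) (hq : q ∈ polyhedron h)
    (hgh : ∀ i, |g i (AffineMap.lineMap q z t) - h i (AffineMap.lineMap q z t)| ≤ t * h i z) :
    AffineMap.lineMap q z t ∈ polyhedron g := fun i => by
  have hclose := (abs_le.1 (hgh i)).1
  have hscaled := mul_nonneg (sub_nonneg.2 ht1) (hq i)
  rw [apply_lineMap_eq (h i)] at hclose
  linarith

theorem hausdorffEDist_inter_polyhedron_le {Ω : Set E} (hΩ : Convex ℝ Ω) {D : ℝ}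
    (hD : ∀ q ∈ Ω, ∀ r ∈ Ω, dist q r ≤ D) {g h : ι → E →ᴬ[ℝ] ℝ} {z : E}
    (hz : z ∈ interior Ω) (hzh : ∀ i, 0 ≤ h i z) {t : ℝ} (ht0 : 0 < t) (ht1 : t < 1)
    (hgh : ∀ i, ∀ q ∈ Ω, |g i q - h i q| ≤ t * h i z) :
    Metric.hausdorffEDist (interior Ω ∩ polyhedron g) (Ω ∩ polyhedron h) ≤
      ENNReal.ofReal (t * D) := by
  have hint : ∀ q ∈ Ω, AffineMap.lineMap q z t ∈ interior Ω := fun q hq => by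
    rw [AffineMap.lineMap_apply_module]
    exact hΩ.combo_self_interior_mem_interior hq hz (by linarith) ht0 (by ring)
  have hdist : ∀ q ∈ Ω, edist q (AffineMap.lineMap q z t) ≤ ENNReal.ofReal (t * D) := by
    intro q hq
    rw [edist_dist, dist_left_lineMap, Real.norm_of_nonneg ht0.le]
    gcongr
    exact hD q hq z (interior_subset hz)
  refine Metric.hausdorffEDist_le_of_mem_edist ?_ ?_
  · rintro q ⟨hq, hqg⟩
    have hqΩ := interior_subset hq
    exact ⟨_, ⟨interior_subset (hint q hqΩ), lineMap_mem_polyhedron_of_abs_sub_le ht0.le ht1.le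
      hzh hqg fun i => hgh i q hqΩ⟩, hdist q hqΩ⟩
  · rintro q ⟨hqΩ, hqh⟩
    exact ⟨_, ⟨hint q hqΩ, lineMap_mem_polyhedron_of_abs_apply_lineMap_sub_le ht1.le hqh
      fun i => hgh i _ (interior_subset (hint q hqΩ))⟩, hdist q hqΩ⟩

theorem tendsto_hausdorffEDist_inter_polyhedron [Finite ι] {l : Filter α} {Ω : Set E}
    (hΩ : Convex ℝ Ω) (hb : Bornology.IsBounded Ω) {g : α → ι → E →ᴬ[ℝ] ℝ}
    {h : ι → E →ᴬ[ℝ] ℝ} (hlim : Tendsto g l (𝓝 h)) {z : E} (hz : z ∈ interior Ω)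
    (hzh : ∀ i, 0 < h i z) :
    Tendsto (fun a => Metric.hausdorffEDist (interior Ω ∩ polyhedron (g a)) (Ω ∩ polyhedron h))
      l (𝓝 0) := by
  obtain ⟨D, hD⟩ := Metric.isBounded_iff.1 hb
  obtain ⟨M, hM⟩ := hb.exists_norm_le
  have hM0 : 0 ≤ M := (norm_nonneg z).trans (hM z (interior_subset hz))
  have hclose (t : ℝ) (ht : 0 < t) : ∀ᶠ a in l, ∀ i, ∀ q ∈ Ω, |g a i q - h i q| ≤ t * h i z := by
    refine eventually_all.2 fun i => ?_
    have hε : 0 < t * h i z / (1 + M) := div_pos (mul_pos ht (hzh i)) (by linarith)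
    filter_upwards [Metric.tendsto_nhds.1 (tendsto_pi_nhds.1 hlim i) _ hε] with a ha q hq
    calc |g a i q - h i q| = |(g a i - h i) q| := rfl
      _ ≤ ‖g a i - h i‖ * (1 + ‖q‖) := abs_apply_le_norm_mul _ q
      _ ≤ t * h i z / (1 + M) * (1 + M) := by
        rw [dist_eq_norm] at ha
        gcongr
        exact hM q hq
      _ = t * h i z := div_mul_cancel₀ _ (by linarith)
  have hsmall : Tendsto (fun t : ℝ => ENNReal.ofReal (t * D)) (𝓝[>] 0) (𝓝 0) :=
    (ENNReal.continuous_ofReal.comp (continuous_mul_const D)).tendsto' 0 0 (by simp)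
      |>.mono_left nhdsWithin_le_nhds
  refine ENNReal.tendsto_nhds_zero.2 fun ε hε => ?_
  obtain ⟨t, htε, ht0, ht1⟩ :=
    ((ENNReal.tendsto_nhds_zero.1 hsmall ε hε).and (Ioo_mem_nhdsGT one_pos)).exists
  filter_upwards [hclose t ht0] with a ha
  exact (hausdorffEDist_inter_polyhedron_le hΩ (fun q hq r hr => hD hq hr) hz
    (fun i => (hzh i).le) ht0 ht1 ha).trans htε

end HausdorffContinuity

section Chord

variable {E : Type*} [NormedAddCommGroup E] [NormedSpace ℝ E] {ι : Type*}
  {f : ι → E →ᴬ[ℝ] ℝ} {p q : E} {t : ℝ}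

theorem isGreatest_sSup_setOf_lineMap_mem {Ω : Set E} (hc : IsCompact Ω) (hq : q ∈ Ω)
    (hpq : p ≠ q) :
    IsGreatest {t : ℝ | AffineMap.lineMap p q t ∈ Ω}
      (sSup {t : ℝ | AffineMap.lineMap p q t ∈ Ω}) := by
  have hemb : IsClosedEmbedding (AffineMap.lineMap p q : ℝ → E) :=
    (antilipschitzWith_lineMap hpq).isClosedEmbedding
      (lipschitzWith_lineMap p q).uniformContinuous
  exact (hemb.isCompact_preimage hc).isGreatest_sSup ⟨1, by simpa using hq⟩

theorem exists_apply_lineMap_eq_zero_of_isGreatest [Finite ι]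
    (ht : IsGreatest {t : ℝ | AffineMap.lineMap p q t ∈ polyhedron f} t) :
    ∃ i, f i (AffineMap.lineMap p q t) = 0 := by
  by_contra! hne
  have hpos : ∀ i, 0 < f i (AffineMap.lineMap p q t) := fun i => (ht.1 i).lt_of_ne (hne i).symm
  have hnear : ∀ᶠ s in 𝓝[>] t, AffineMap.lineMap p q s ∈ {y | ∀ i, 0 < f i y} :=
    nhdsWithin_le_nhds <| AffineMap.lineMap_continuous.continuousAt.eventually_mem <|
      (isOpen_setOf_forall_pos f).mem_nhds hpos
  obtain ⟨s, hs, hts⟩ := (hnear.and self_mem_nhdsWithin).exists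
  exact (ht.2 fun i => (hs i).le : s ≤ t).not_gt hts

theorem one_lt_of_isGreatest [Finite ι] (hq : ∀ i, 0 < f i q)
    (ht : IsGreatest {t : ℝ | AffineMap.lineMap p q t ∈ polyhedron f} t) : 1 < t := by
  obtain ⟨i, hi⟩ := exists_apply_lineMap_eq_zero_of_isGreatest ht
  refine (ht.2 fun j => ?_ : 1 ≤ t).lt_of_ne fun h => ?_
  · simpa using (hq j).le
  · rw [← h, AffineMap.lineMap_apply_one] at hi
    exact (hq i).ne' hi

theorem isGreatest_range_div_of_isGreatest [Finite ι] (hq : ∀ i, 0 < f i q)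
    (ht : IsGreatest {t : ℝ | AffineMap.lineMap p q t ∈ polyhedron f} t) :
    IsGreatest (Set.range fun i => f i p / f i q) (t / (t - 1)) := by
  have ht1 : 0 < t - 1 := sub_pos.2 (one_lt_of_isGreatest hq ht)
  obtain ⟨i, hi⟩ := exists_apply_lineMap_eq_zero_of_isGreatest ht
  rw [apply_lineMap_eq] at hi
  refine ⟨⟨i, ?_⟩, Set.forall_mem_range.2 fun j => ?_⟩
  · rw [div_eq_div_iff (hq i).ne' ht1.ne']
    linarith
  · have hj := ht.1 j
    rw [apply_lineMap_eq] at hj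
    rw [div_le_div_iff₀ (hq j) ht1]
    linarith

theorem norm_sub_lineMap_div_norm_sub_lineMap (hpq : p ≠ q) (ht : 1 < t) :
    ‖p - AffineMap.lineMap p q t‖ / ‖q - AffineMap.lineMap p q t‖ = t / (t - 1) := by
  rw [← dist_eq_norm, ← dist_eq_norm, dist_left_lineMap, dist_right_lineMap,
    Real.norm_of_nonneg (by linarith), Real.norm_of_nonpos (by linarith),
    mul_div_mul_right _ _ (dist_ne_zero.2 hpq), neg_sub]

end Chord

section ProductRange

variable {ι κ : Type*}

theorem isGreatest_range_mul {a : ι → ℝ} {b : κ → ℝ} {A B : ℝ} (ha : ∀ i, 0 ≤ a i)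
    (hb : ∀ j, 0 ≤ b j) (hA : IsGreatest (Set.range a) A) (hB : IsGreatest (Set.range b) B) :
    IsGreatest (Set.range fun k : ι × κ => a k.1 * b k.2) (A * B) := by
  obtain ⟨⟨i, rfl⟩, hi⟩ := hA
  obtain ⟨⟨j, rfl⟩, hj⟩ := hB
  exact ⟨⟨(i, j), rfl⟩, Set.forall_mem_range.2 fun k =>
    mul_le_mul (hi ⟨k.1, rfl⟩) (hj ⟨k.2, rfl⟩) (hb _) (ha _)⟩

theorem isGreatest_range_norm [Fintype ι] [Nonempty ι] {a : ι → ℝ} (ha : ∀ i, 0 ≤ a i) :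
    IsGreatest (Set.range a) ‖a‖ := by
  obtain ⟨i, hi⟩ := Finite.exists_max a
  refine ⟨⟨i, le_antisymm ?_ ?_⟩, Set.forall_mem_range.2 fun j => ?_⟩
  · exact (le_abs_self _).trans (norm_le_pi_norm a i)
  · exact (pi_norm_le_iff_of_nonneg (ha i)).2 fun j => by
      simpa [Real.norm_of_nonneg (ha j)] using hi j
  · exact (le_abs_self _).trans (norm_le_pi_norm a j)

theorem isGreatest_range_mul_norm [Fintype ι] [Nonempty ι] {a b : ι → ℝ} (ha : ∀ i, 0 ≤ a i)
    (hb : ∀ j, 0 ≤ b j) :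
    IsGreatest (Set.range fun k : ι × ι => a k.1 * b k.2) (‖a‖ * ‖b‖) :=
  isGreatest_range_mul ha hb (isGreatest_range_norm ha) (isGreatest_range_norm hb)

end ProductRange

section Hilbert

variable {ι : Type*} [Finite ι] {f : ι → Plane →ᴬ[ℝ] ℝ} {c p q : Plane}

theorem isGreatest_range_div_chordEnd (hc : IsCompact (polyhedron f)) (hq : ∀ i, 0 < f i q)
    (hpq : p ≠ q) :
    IsGreatest (Set.range fun i => f i p / f i q)
      (‖p - chordEnd (polyhedron f) p q‖ / ‖q - chordEnd (polyhedron f) p q‖) := by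
  have ht := isGreatest_sSup_setOf_lineMap_mem hc (fun i => (hq i).le) hpq
  rw [chordEnd, norm_sub_lineMap_div_norm_sub_lineMap hpq (one_lt_of_isGreatest hq ht)]
  exact isGreatest_range_div_of_isGreatest hq ht

theorem isGreatest_exp_two_mul_hilbertDist [Nonempty ι] (hb : IsCompact (polyhedron f))
    (hc : ∀ i, 0 < f i c) (hq : ∀ i, 0 < f i q) :
    IsGreatest (Set.range fun k : ι × ι => f k.1 c / f k.1 q * (f k.2 q / f k.2 c))
      (Real.exp (2 * hilbertDist (polyhedron f) c q)) := by
  rcases eq_or_ne c q with rfl | hne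
  · have hone : ∀ i, f i c / f i c = 1 := fun i => div_self (hc i).ne'
    simp [hone, hilbertDist]
  · have hcq := isGreatest_range_div_chordEnd hb hq hne
    have hqc := isGreatest_range_div_chordEnd hb hc hne.symm
    have hprod := isGreatest_range_mul (fun i => (div_pos (hc i) (hq i)).le)
      (fun i => (div_pos (hq i) (hc i)).le) hcq hqc
    obtain ⟨k, hk⟩ := hprod.1
    have hpos := mul_pos (div_pos (hc k.1) (hq k.1)) (div_pos (hq k.2) (hc k.2))
    convert hprod using 1
    rw [hilbertDist, if_neg hne, ← mul_assoc, mul_one_div_cancel two_ne_zero, one_mul,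
      mul_comm (_ / _), Real.exp_log (hk ▸ hpos)]

end Hilbert

section RatioConstraint

variable {E : Type*} [NormedAddCommGroup E] [NormedSpace ℝ E] {ι : Type*} [Fintype ι]
  {f : ι → E →ᴬ[ℝ] ℝ} {a b : ι → ℝ} {q : E}

/-- The affine inequality `a i * b j * f j q ≤ ‖a‖ * ‖b‖ * f i q` in `q`, where `k = (i, j)` and the
norms are sup norms. With `a i = f i c` and `b j = (f j c)⁻¹` it says that the product of ratios
`(f i c / f i q) * (f j q / f j c)` is at most the maximum of such products at a point `p` where all
`f i` are `1`, so these inequalities cut out the Hilbert ball centered at `c` through `p`. -/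
def ratioConstraint (f : ι → E →ᴬ[ℝ] ℝ) (a b : ι → ℝ) (k : ι × ι) : E →ᴬ[ℝ] ℝ :=
  (‖a‖ * ‖b‖) • f k.1 - (a k.1 * b k.2) • f k.2

theorem ratioConstraint_apply (f : ι → E →ᴬ[ℝ] ℝ) (a b : ι → ℝ) (k : ι × ι) (q : E) :
    ratioConstraint f a b k q = ‖a‖ * ‖b‖ * f k.1 q - a k.1 * b k.2 * f k.2 q :=
  rfl

theorem tendsto_ratioConstraint {α : Type*} {l : Filter α} (f : ι → E →ᴬ[ℝ] ℝ)
    {a b : α → ι → ℝ} {a₀ b₀ : ι → ℝ} (ha : Tendsto a l (𝓝 a₀)) (hb : Tendsto b l (𝓝 b₀)) :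
    Tendsto (fun t => ratioConstraint f (a t) (b t)) l (𝓝 (ratioConstraint f a₀ b₀)) :=
  tendsto_pi_nhds.2 fun _ => ((ha.norm.mul hb.norm).smul_const _).sub
    (((tendsto_pi_nhds.1 ha _).mul (tendsto_pi_nhds.1 hb _)).smul_const _)

theorem polyhedron_ratioConstraint_smul (f : ι → E →ᴬ[ℝ] ℝ) (a b : ι → ℝ) {δ : ℝ} (hδ : 0 < δ) :
    polyhedron (ratioConstraint f a (δ • b)) = polyhedron (ratioConstraint f a b) := by
  have hscale (k : ι × ι) (q : E) :
      ratioConstraint f a (δ • b) k q = δ * ratioConstraint f a b k q := by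
    simp only [ratioConstraint_apply, norm_smul, Real.norm_of_nonneg hδ.le, Pi.smul_apply,
      smul_eq_mul]
    ring
  ext q
  exact forall_congr' fun k => by rw [hscale, mul_nonneg_iff_of_pos_left hδ]

theorem mem_polyhedron_ratioConstraint [Nonempty ι] (ha : ∀ i, 0 ≤ a i) (hb : ∀ j, 0 ≤ b j)
    (hq : ∀ i, f i q = 1) : q ∈ polyhedron (ratioConstraint f a b) := fun k => by
  rw [ratioConstraint_apply, hq, hq, mul_one, mul_one, sub_nonneg]
  exact (isGreatest_range_mul_norm ha hb).2 ⟨k, rfl⟩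

theorem exists_ratioConstraint_eq_zero [Nonempty ι] (ha : ∀ i, 0 ≤ a i) (hb : ∀ j, 0 ≤ b j)
    (hq : ∀ i, f i q = 1) : ∃ k, ratioConstraint f a b k q = 0 := by
  obtain ⟨k, hk⟩ := (isGreatest_range_mul_norm ha hb).1
  exact ⟨k, by rw [ratioConstraint_apply, hq, hq, mul_one, mul_one, sub_eq_zero, ← hk]⟩

end RatioConstraint

section FiniteBalls

variable {ι : Type*} [Fintype ι] [Nonempty ι] {f : ι → Plane →ᴬ[ℝ] ℝ} {c p : Plane}

theorem exp_two_mul_hilbertDist_eq_norm_mul_norm (hb : IsCompact (polyhedron f))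
    (hfp : ∀ i, f i p = 1) (hc : ∀ i, 0 < f i c) :
    Real.exp (2 * hilbertDist (polyhedron f) c p) =
      ‖fun i => f i c‖ * ‖fun j => (f j c)⁻¹‖ := by
  have hmax := isGreatest_exp_two_mul_hilbertDist hb hc fun i => hfp i ▸ one_pos
  simp only [hfp, div_one, one_div] at hmax
  exact hmax.unique
    (isGreatest_range_mul_norm (fun i => (hc i).le) fun j => (inv_pos.2 (hc j)).le)

theorem hilbertDist_le_iff_mem_polyhedron_ratioConstraint (hb : IsCompact (polyhedron f))
    (hfp : ∀ i, f i p = 1) (hc : ∀ i, 0 < f i c) {q : Plane} (hq : ∀ i, 0 < f i q) :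
    hilbertDist (polyhedron f) c q ≤ hilbertDist (polyhedron f) c p ↔
      q ∈ polyhedron (ratioConstraint f (fun i => f i c) fun j => (f j c)⁻¹) := by
  rw [← mul_le_mul_iff_of_pos_left two_pos, ← Real.exp_le_exp,
    exp_two_mul_hilbertDist_eq_norm_mul_norm hb hfp hc,
    isLUB_le_iff (isGreatest_exp_two_mul_hilbertDist hb hc hq).isLUB,
    mem_upperBounds, Set.forall_mem_range]
  refine forall_congr' fun k => ?_
  rw [ratioConstraint_apply, sub_nonneg, div_mul_eq_mul_div, div_le_iff₀ (hq _), mul_div_assoc',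
    mul_div_right_comm, div_eq_mul_inv]

theorem hilbertBallThrough_polyhedron_eq (hb : IsCompact (polyhedron f))
    (hfp : ∀ i, f i p = 1) (hc : ∀ i, 0 < f i c) :
    hilbertBallThrough (polyhedron f) c p =
      interior (polyhedron f) ∩
        polyhedron (ratioConstraint f (fun i => f i c) fun j => (f j c)⁻¹) := by
  have hp : ∀ i, 0 < f i p := fun i => hfp i ▸ one_pos
  refine Set.ext fun q => and_congr_right fun hq => ?_
  rw [interior_polyhedron hp] at hq
  exact hilbertDist_le_iff_mem_polyhedron_ratioConstraint hb hfp hc hq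

end FiniteBalls

section ContactWeight

variable {E : Type*} [NormedAddCommGroup E] [NormedSpace ℝ E] {ι : Type*}
  {f : ι → E →ᴬ[ℝ] ℝ} {x u : E}

open Classical in
/-- The limit of `δ / f j (x + δ • u)` as `δ` decreases to `0`: the inverse of the
slope along `u` of a constraint active at `x`, and `0` for an inactive one. -/
noncomputable def contactWeight (f : ι → E →ᴬ[ℝ] ℝ) (x u : E) (j : ι) : ℝ :=
  if f j x = 0 then ((f j).contLinear u)⁻¹ else 0

theorem contactWeight_nonneg (hu : ∀ i, f i x = 0 → 0 < (f i).contLinear u) (j : ι) :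
    0 ≤ contactWeight f x u j := by
  unfold contactWeight
  split_ifs with hj
  · exact (inv_pos.2 (hu j hj)).le
  · exact le_rfl

theorem contactWeight_mul_apply_add_smul_le (hu : ∀ i, f i x = 0 → 0 < (f i).contLinear u)
    (j : ι) {t : ℝ} (ht : 0 ≤ t) : contactWeight f x u j * f j (x + t • u) ≤ t := by
  unfold contactWeight
  split_ifs with hj
  · rw [apply_add_smul_eq, hj, zero_add, mul_comm t, inv_mul_cancel_left₀ (hu j hj).ne']
  · rwa [zero_mul]

theorem tendsto_smul_inv_apply_add_smul (f : ι → E →ᴬ[ℝ] ℝ) (x u : E) :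
    Tendsto (fun δ : ℝ => δ • fun j => (f j (x + δ • u))⁻¹) (𝓝[>] 0)
      (𝓝 (contactWeight f x u)) := by
  refine tendsto_pi_nhds.2 fun j => ?_
  simp only [Pi.smul_apply, smul_eq_mul, apply_add_smul_eq]
  by_cases hj : f j x = 0
  · refine tendsto_const_nhds.congr' ?_
    filter_upwards [self_mem_nhdsWithin] with δ hδ
    rw [contactWeight, if_pos hj, hj, zero_add, mul_inv,
      mul_inv_cancel_left₀ (ne_of_gt (Set.mem_Ioi.1 hδ))]
  · rw [contactWeight, if_neg hj]
    refine Tendsto.mono_left ?_ nhdsWithin_le_nhds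
    have hden : Tendsto (fun δ : ℝ => f j x + δ * (f j).contLinear u) (𝓝 0) (𝓝 (f j x)) :=
      (by fun_prop : Continuous _).tendsto' 0 _ (by simp)
    simpa using tendsto_id.mul (hden.inv₀ hj)

theorem eventually_mul_apply_lt_mul_apply_add_smul [Finite ι] (hx : x ∈ polyhedron f)
    (hu : ∀ i, f i x = 0 → 0 < (f i).contLinear u) {S : ℝ} (hS : 0 < S) :
    ∀ᶠ t in 𝓝[>] (0 : ℝ), ∀ i, t * f i x < S * f i (x + t • u) := by
  refine eventually_all.2 fun i => ?_
  simp only [apply_add_smul_eq]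
  rcases (hx i).eq_or_lt with htight | hloose
  · filter_upwards [self_mem_nhdsWithin] with t ht
    rw [← htight, mul_zero, zero_add]
    exact mul_pos hS (mul_pos ht (hu i htight.symm))
  · refine nhdsWithin_le_nhds (ContinuousAt.eventually_lt ?_ ?_ ?_)
    · fun_prop
    · fun_prop
    · simpa using mul_pos hS hloose

end ContactWeight

section BallAtInfinity

variable {E : Type*} [NormedAddCommGroup E] [NormedSpace ℝ E] {ι : Type*} [Fintype ι]
  {f : ι → E →ᴬ[ℝ] ℝ} {x u p : E}

/-- The affine inequalities defining the Hilbert ball at infinity of `polyhedron f` determined by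
`x` and `u` and passing through a point where all `f i` are `1`: those of the polyhedron itself and
the limits of the constraints on the Hilbert balls centered at `x + δ • u`. -/
noncomputable def ballAtInfinityConstraint (f : ι → E →ᴬ[ℝ] ℝ) (x u : E) :
    ι ⊕ ι × ι → E →ᴬ[ℝ] ℝ :=
  Sum.elim f (ratioConstraint f (fun i => f i x) (contactWeight f x u))

theorem polyhedron_ballAtInfinityConstraint (f : ι → E →ᴬ[ℝ] ℝ) (x u : E) :
    polyhedron (ballAtInfinityConstraint f x u) =
      polyhedron f ∩ polyhedron (ratioConstraint f (fun i => f i x) (contactWeight f x u)) :=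
  polyhedron_sumElim _ _

theorem tendsto_ratioConstraint_add_smul (f : ι → E →ᴬ[ℝ] ℝ) (x u : E) :
    Tendsto (fun δ : ℝ =>
        ratioConstraint f (fun i => f i (x + δ • u)) (δ • fun j => (f j (x + δ • u))⁻¹))
      (𝓝[>] 0) (𝓝 (ratioConstraint f (fun i => f i x) (contactWeight f x u))) := by
  have hvalues : Tendsto (fun δ : ℝ => fun i => f i (x + δ • u)) (𝓝[>] 0)
      (𝓝 fun i => f i x) := by
    refine Tendsto.mono_left ?_ nhdsWithin_le_nhds
    exact (by fun_prop : Continuous _).tendsto' 0 _ (by simp)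
  exact tendsto_ratioConstraint f hvalues (tendsto_smul_inv_apply_add_smul f x u)

theorem norm_contactWeight_pos (hx : ∃ i, f i x = 0)
    (hu : ∀ i, f i x = 0 → 0 < (f i).contLinear u) : 0 < ‖contactWeight f x u‖ := by
  obtain ⟨j, hj⟩ := hx
  refine norm_pos_iff.2 (Function.ne_iff.2 ⟨j, ?_⟩)
  rw [contactWeight, if_pos hj]
  exact (inv_pos.2 (hu j hj)).ne'

theorem eventually_ballAtInfinityConstraint_add_smul_pos (hx : x ∈ polyhedron f)
    (hx_loose : ∃ i, f i x ≠ 0) (hx_tight : ∃ i, f i x = 0)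
    (hu : ∀ i, f i x = 0 → 0 < (f i).contLinear u) :
    ∀ᶠ t in 𝓝[>] (0 : ℝ), ∀ k, 0 < ballAtInfinityConstraint f x u k (x + t • u) := by
  have hS : 0 < ‖fun i => f i x‖ * ‖contactWeight f x u‖ :=
    mul_pos (norm_pos_iff.2 (Function.ne_iff.2 hx_loose)) (norm_contactWeight_pos hx_tight hu)
  filter_upwards [eventually_mul_apply_lt_mul_apply_add_smul hx hu hS, self_mem_nhdsWithin]
    with t hlt ht
  have ht0 : 0 < t := ht
  refine Sum.rec (fun i => ?_) fun k => sub_pos.2 ?_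
  · exact pos_of_mul_pos_right ((mul_nonneg ht0.le (hx i)).trans_lt (hlt i)) hS.le
  · calc f k.1 x * contactWeight f x u k.2 * f k.2 (x + t • u)
        = f k.1 x * (contactWeight f x u k.2 * f k.2 (x + t • u)) := mul_assoc _ _ _
      _ ≤ f k.1 x * t := mul_le_mul_of_nonneg_left
          (contactWeight_mul_apply_add_smul_le hu k.2 ht0.le) (hx k.1)
      _ < ‖fun i => f i x‖ * ‖contactWeight f x u‖ * f k.1 (x + t • u) :=
          mul_comm t _ ▸ hlt k.1

theorem mem_polyhedron_ballAtInfinityConstraint (hx : x ∈ polyhedron f)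
    (hu : ∀ i, f i x = 0 → 0 < (f i).contLinear u) :
    x ∈ polyhedron (ballAtInfinityConstraint f x u) := by
  refine Sum.rec hx fun k => sub_nonneg.2 ?_
  have hweight := contactWeight_mul_apply_add_smul_le hu k.2 le_rfl
  rw [zero_smul, add_zero] at hweight
  calc f k.1 x * contactWeight f x u k.2 * f k.2 x
      = f k.1 x * (contactWeight f x u k.2 * f k.2 x) := mul_assoc _ _ _
    _ ≤ 0 := mul_nonpos_of_nonneg_of_nonpos (hx k.1) hweight
    _ ≤ ‖fun i => f i x‖ * ‖contactWeight f x u‖ * f k.1 x :=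
        mul_nonneg (by positivity) (hx k.1)

theorem self_mem_frontier_ballAtInfinity {z : E}
    (hz : ∀ k, 0 < ballAtInfinityConstraint f x u k z) (hx : x ∈ polyhedron f)
    (hx_tight : ∃ i, f i x = 0) (hu : ∀ i, f i x = 0 → 0 < (f i).contLinear u) :
    x ∈ frontier (polyhedron (ballAtInfinityConstraint f x u)) :=
  (mem_frontier_polyhedron_iff hz).2
    ⟨mem_polyhedron_ballAtInfinityConstraint hx hu, hx_tight.imp' Sum.inl fun _ => id⟩

theorem mem_frontier_ballAtInfinity_of_forall_apply_eq_one [Nonempty ι] {z : E}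
    (hz : ∀ k, 0 < ballAtInfinityConstraint f x u k z) (hx : x ∈ polyhedron f)
    (hu : ∀ i, f i x = 0 → 0 < (f i).contLinear u) (hfp : ∀ i, f i p = 1) :
    p ∈ frontier (polyhedron (ballAtInfinityConstraint f x u)) := by
  have hw := contactWeight_nonneg hu
  obtain ⟨k, hk⟩ := exists_ratioConstraint_eq_zero (a := fun i => f i x) hx hw hfp
  refine (mem_frontier_polyhedron_iff hz).2 ⟨Sum.rec (fun i => ?_) ?_, Sum.inr k, hk⟩
  · exact (zero_le_one.trans_eq (hfp i).symm : 0 ≤ f i p)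
  · exact mem_polyhedron_ratioConstraint (a := fun i => f i x) hx hw hfp

end BallAtInfinity

theorem isConvexPolygon_polyhedron {ι : Type*} [Finite ι] {f : ι → Plane →ᴬ[ℝ] ℝ} {z : Plane}
    (hc : IsCompact (polyhedron f)) (hz : ∀ i, 0 < f i z) : IsConvexPolygon (polyhedron f) :=
  ⟨exists_finset_polyhedron_eq_convexHull hc, z, (interior_polyhedron hz).symm ▸ hz⟩

section Convergence

variable {ι : Type*} [Fintype ι] {f : ι → Plane →ᴬ[ℝ] ℝ} {x u p : Plane}

theorem eventually_hilbertBallThrough_add_smul_eq [Nonempty ι] (hc : IsCompact (polyhedron f))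
    (hfp : ∀ i, f i p = 1) (hxu : ∀ᶠ δ in 𝓝[>] (0 : ℝ), ∀ i, 0 < f i (x + δ • u)) :
    ∀ᶠ δ in 𝓝[>] (0 : ℝ), hilbertBallThrough (polyhedron f) (x + δ • u) p =
      interior (polyhedron f) ∩ polyhedron
        (ratioConstraint f (fun i => f i (x + δ • u)) (δ • fun j => (f j (x + δ • u))⁻¹)) := by
  filter_upwards [hxu, self_mem_nhdsWithin] with δ hδu hδ
  rw [hilbertBallThrough_polyhedron_eq hc hfp hδu, polyhedron_ratioConstraint_smul f _ _ hδ]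

theorem isHilbertBallAtInfinity_polyhedron [Nonempty ι] (hc : IsCompact (polyhedron f))
    (hfp : ∀ i, f i p = 1) (hxu : ∀ᶠ δ in 𝓝[>] (0 : ℝ), ∀ k,
      0 < ballAtInfinityConstraint f x u k (x + δ • u)) :
    IsHilbertBallAtInfinity (polyhedron f) x u p
      (polyhedron (ballAtInfinityConstraint f x u)) := by
  obtain ⟨δ, hz⟩ := hxu.exists
  have hp : ∀ i, 0 < f i p := fun i => hfp i ▸ one_pos
  refine ⟨⟨_, fun k => (hz k).le⟩, ?_, ?_⟩
  · rw [polyhedron_ballAtInfinityConstraint]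
    exact hc.inter_right (isClosed_polyhedron _)
  · rw [polyhedron_ballAtInfinityConstraint]
    refine (tendsto_hausdorffEDist_inter_polyhedron (convex_polyhedron f) hc.isBounded
      (tendsto_ratioConstraint_add_smul f x u) (z := x + δ • u) ?_
      fun k => hz (Sum.inr k)).congr' ?_
    · rw [interior_polyhedron hp]
      exact fun i => hz (Sum.inl i)
    · filter_upwards [eventually_hilbertBallThrough_add_smul_eq hc hfp
        (hxu.mono fun _ hpos i => hpos (Sum.inl i))] with δ hδ
      rw [hδ]

theorem IsHilbertBallAtInfinity.unique {Ω K K' : Set Plane}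
    (h : IsHilbertBallAtInfinity Ω x u p K) (h' : IsHilbertBallAtInfinity Ω x u p K') :
    K' = K := by
  obtain ⟨-, hK, hlim⟩ := h
  obtain ⟨-, hK', hlim'⟩ := h'
  rw [← hK'.isClosed.hausdorffEDist_zero_iff hK.isClosed]
  have hsum := hlim'.add hlim
  rw [add_zero] at hsum
  refine le_antisymm (ge_of_tendsto' hsum fun δ => ?_) bot_le
  rw [Metric.hausdorffEDist_comm (t := K')]
  exact Metric.hausdorffEDist_triangle

end Convergence

theorem mainTheorem10 (Ω : Set Plane) (hΩ : IsConvexPolygon Ω)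
    (x : Plane) (hx : x ∈ frontier Ω)
    (u : Plane) (hu : IsInwardDirection Ω x u)
    (p : Plane) (hp : p ∈ interior Ω) :
    ∃ K : Set Plane,
      IsHilbertBallAtInfinity Ω x u p K ∧
      (∀ K' : Set Plane, IsHilbertBallAtInfinity Ω x u p K' → K' = K) ∧
      IsConvexPolygon K ∧ K ⊆ Ω ∧ x ∈ frontier K ∧ p ∈ frontier K := by
  obtain ⟨⟨V, rfl⟩, -⟩ := hΩ
  obtain ⟨W, f, hfp, hf⟩ := exists_convexHull_eq_polyhedron V hp
  have hc : IsCompact (polyhedron f) := hf ▸ V.finite_toSet.isCompact_convexHull ℝ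
  rw [hf] at hx hp hu ⊢
  have hpos : ∀ i, 0 < f i p := fun i => hfp i ▸ one_pos
  obtain ⟨hxΩ, hx_tight⟩ := (mem_frontier_polyhedron_iff hpos).1 hx
  have : Nonempty W := ⟨hx_tight.choose⟩
  have hxp : x ≠ p := fun h => hx.2 (h ▸ hp)
  have hx_loose := exists_apply_ne_zero_of_isBounded hc.isBounded (interior_subset hp) hxp
  obtain ⟨-, t, ht, htu⟩ := hu
  rw [interior_polyhedron hpos] at htu
  have hslope : ∀ i, f i x = 0 → 0 < (f i).contLinear u := fun i hi =>
    contLinear_pos_of_apply_add_smul_pos ht hi (htu i)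
  have hxu := eventually_ballAtInfinityConstraint_add_smul_pos hxΩ hx_loose hx_tight hslope
  have hK := isHilbertBallAtInfinity_polyhedron hc hfp hxu
  obtain ⟨_, hz⟩ := hxu.exists
  exact ⟨_, hK, fun K' => hK.unique, isConvexPolygon_polyhedron hK.2.1 hz,
    polyhedron_ballAtInfinityConstraint f x u ▸ Set.inter_subset_left,
    self_mem_frontier_ballAtInfinity hz hxΩ hx_tight hslope,
    mem_frontier_ballAtInfinity_of_forall_apply_eq_one hz hxΩ hslope hfp⟩
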